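/- Let $A$ be an expanding real $d\times d$ matrix (all its eigenvalues $z$ satisfy $|z|>1$), and let $\mathcal D_{ij}\subset\mathbb R^d$ ($1\le i,j\le n$) be finite sets. Assume that the nonnegative subdivision matrix $S=[\,|\mathcal D_{ij}|\,]_{1\le i,j\le n}$ is primitive (some power $S^k$, $k\ge 1$, has all entries strictly positive) and that its Perron eigenvalue (its spectral radius) satisfies $\lambda(S)=|\det A|$. Let $T_1,\dots,T_n\subset\mathbb R^d$ be compact sets, not all empty, satisfying the multi-tile functional equation $$A(T_i)=\bigcup_{j=1}^n\,(T_j+\mathcal D_{ji}),\qquad 1\le i\le n.$$ For $m\ge1$ and $1\le j,i\le n$ let $\mathcal D^m_{ji}$ be the finite multiset $$\mathcal D^m_{ji}=\bigvee_{j_1,\dots,j_{m-1}=1}^n\bigl(\mathcal D_{jj_{m-1}}+A\mathcal D_{j_{m-1}j_{m-2}}+\cdots+A^{m-1}\mathcal D_{j_1i}\bigr),$$ where sums and the union $\bigvee$ are formed counting multiplicities (so $\mathcal D^1_{ji}=\mathcal D_{ji}$). A multiset is an ordinary set if all its multiplicities are one, and it is uniformly discrete if for some $r>0$ each open ball of radius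 $r$ contains at most one of its points, counted with multiplicity. A family $\{\mathcal E_\alpha\}$ of multisets in $\mathbb R^d$ is equi-uniformly discrete if there is $\varepsilon_0>0$ such that each $\mathcal E_\alpha$ is uniformly discrete and any two distinct elements of $\mathcal E_\alpha$ are at distance at least $\varepsilon_0$; it is weakly equi-uniformly discrete if there is $M>0$ such that, for every $\alpha$, each ball of radius $1$ contains at most $M$ elements of $\mathcal E_\alpha$, counted with multiplicity. Let $\mu$ be Lebesgue measure on $\mathbb R^d$. Then the following conditions are equivalent: (i) all multisets $\mathcal D^m_{jk}$ ($1\le j,k\le n$, $m\ge1$) are ordinary sets, and the family $\{\mathcal D^m_{jk}:1\le j,k\le n,\ m\ge1\}$ is equi-uniformly discrete; (ii) for some fixed $1\le k,l\le n$, the multisets $\mathcal D^m_{kl}$, $m\ge1$, are ordinary sets, and the family $\{\mathcal D^m_{kl}:m\ge1\}$ is equi-uniformly discrete; (iii) the family $\{\mathcal D^m_{jk}:1\le j,k\le n,\ m\ge1\}$ is weakly equi-uniformly discrete; (iv) for some fixed $1\le k,l\le n$, the family $\{\mathcal D^m_{kl}:m\ge1\}$ is weakly equi-uniformly discrete; (v)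 $\mu(T_j)>0$ for at least one $j$; (vi) $T_j=\overline{T_j^\circ}$ for every $1\le j\le n$; (vii) $T_j=\overline{T_j^\circ}$ for every $1\le j\le n$, and $\mu(\partial T_k)=0$ for every $1\le k\le n$. Moreover, if (vi) holds then $\mu(T_j)>0$ for all $1\le j\le n$. -/

import Mathlib

open scoped Pointwise

noncomputable section

/-- A real square matrix is expanding if all its (complex) eigenvalues `z` satisfy `|z| > 1`. -/
def IsExpanding {d : ℕ} (A : Matrix (Fin d) (Fin d) ℝ) : Prop :=
  ∀ z ∈ spectrum ℂ (A.map (fun x : ℝ => (x : ℂ))), 1 < ‖z‖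

/-- The subdivision matrix `S = [|D i j|]` of a system of finite digit sets. -/
def subdivisionMatrix {d n : ℕ} (D : Fin n → Fin n → Finset (EuclideanSpace ℝ (Fin d))) :
    Matrix (Fin n) (Fin n) ℝ :=
  Matrix.of fun i j => ((D i j).card : ℝ)

/-- The Perron eigenvalue of a (primitive nonnegative) real matrix: its spectral radius, i.e. the
largest modulus of a complex eigenvalue. -/
def perronEigenvalue {n : ℕ} (M : Matrix (Fin n) (Fin n) ℝ) : ℝ :=
  (spectralRadius ℂ (M.map (fun x : ℝ => (x : ℂ)))).toReal

/-- The multi-tile functional equation `A (T i) = ⋃ j, (T j + D j i)` for all `i`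
(an equality of sets, without multiplicities). -/
def SatisfiesMultiTile {d n : ℕ} (A : Matrix (Fin d) (Fin d) ℝ)
    (D : Fin n → Fin n → Finset (EuclideanSpace ℝ (Fin d)))
    (T : Fin n → Set (EuclideanSpace ℝ (Fin d))) : Prop :=
  ∀ i, Matrix.toEuclideanLin A '' T i =
    ⋃ j, (T j + (D j i : Set (EuclideanSpace ℝ (Fin d))))

/-- The multiset sum `X + Y = ⋁_{y ∈ Y} (X + y)`, counted with multiplicities. -/
def multisetSum {E : Type*} [Add E] (X Y : Multiset E) : Multiset E :=
  Y.bind fun y => X.map fun x => x + y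

/-- The iterated digit multisets. For `m ≥ 1`,
`digitMultiset A D m j i` is the union with multiplicities, over all
`j₁, …, j_{m-1}`, of the multiset sums
`D j j_{m-1} + A (D j_{m-1} j_{m-2}) + ⋯ + A ^ (m-1) (D j₁ i)`.
It is defined by recursion on `m`, splitting off the outermost digit set:
the step sums over `k = j_m` (on `Multiset`, `+` and `∑` add the multiplicities),
and the value at `m = 0` is `{0}` if `j = i` and empty otherwise, so that the value at `m = 1`
is `D j i`. -/
def digitMultiset {d n : ℕ} (A : Matrix (Fin d) (Fin d) ℝ)
    (D : Fin n → Fin n → Finset (EuclideanSpace ℝ (Fin d))) :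
    ℕ → Fin n → Fin n → Multiset (EuclideanSpace ℝ (Fin d))
  | 0, j, i => if j = i then {0} else 0
  | m + 1, j, i =>
      ∑ k, multisetSum (D j k).val ((digitMultiset A D m k i).map (Matrix.toEuclideanLin A))

open Classical in
/-- The number of elements of the multiset `X` in the set `B`, counted with multiplicity. -/
def countIn {E : Type*} (X : Multiset E) (B : Set E) : ℕ :=
  X.countP (fun x => x ∈ B)

/-- A multiset is uniformly discrete if for some `r > 0` each open ball of radius `r` contains at
most one of its points, counted with multiplicity. -/
def UniformlyDiscrete {E : Type*} [PseudoMetricSpace E] (X : Multiset E) : Prop :=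
  ∃ r : ℝ, 0 < r ∧ ∀ c : E, countIn X (Metric.ball c r) ≤ 1

/-- A family of multisets is equi-uniformly discrete if, for some `ε > 0`, each member is uniformly
discrete and any two distinct elements of a member have distance at least `ε`. -/
def EquiUniformlyDiscrete {ι E : Type*} [PseudoMetricSpace E] (X : ι → Multiset E) : Prop :=
  ∃ ε : ℝ, 0 < ε ∧ ∀ a, UniformlyDiscrete (X a) ∧
    ∀ x ∈ X a, ∀ y ∈ X a, x ≠ y → ε ≤ dist x y

/-- A family of multisets is weakly equi-uniformly discrete if, for some `M`, each ball of radius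
`1` contains at most `M` elements of each member, counted with multiplicity. -/
def WeaklyEquiUniformlyDiscrete {ι E : Type*} [PseudoMetricSpace E] (X : ι → Multiset E) : Prop :=
  ∃ M : ℕ, ∀ a, ∀ c : E, countIn (X a) (Metric.ball c 1) ≤ M

end

/-! Iterating the functional equation writes `A ^ m (T i)` as the union of the tiles `x + T j` with
`x` in the `m`-th digit multiset (`mem_image_pow_iff`). There are `(S ^ m) j i` tiles of type `j`,
and since the Perron eigenvalue is `|det A|`, this number grows at the same rate as the volume of `A
^ m (T i)`. The theorem compares the two.

Bounded density gives positive measure: around the digits sit at least `c |det A| ^ m` equal balls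
with bounded overlap, all inside `A ^ m U` for any open `U ⊇ T l` once `m` is large, so `U` cannot
be too small (`exists_const_mul_volume_ball_le`).

Positive measure gives separation: the volumes form a nonnegative sub-eigenvector of `S`, hence a
positive eigenvector, and the tiles overlap in null sets. Two close digits of one type would violate
this (`exists_separation_of_volume_pos`).

Positive measure also gives interior: otherwise boundedly many nowhere dense tiles meet each unit
ball, so each unit ball contains a ball of fixed radius missing `A ^ m (T i)`. The counting bound
for `U \ T i` then contradicts outer regularity. Primitivity passes interior points to every tile
and expansion makes them dense. Finally the frontiers subdivide in the same way, but a tile deep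
inside `A ^ m (T i)` contributes nothing, which excludes the eigenvector case. -/

/-! ### Growth of the powers of a matrix -/

open Filter in
/-- Gelfand's formula as an upper bound for the norms of powers. -/
lemma eventually_norm_pow_le_of_spectralRadius_lt {B : Type*} [NormedRing B] [NormedAlgebra ℂ B]
    [CompleteSpace B] (a : B) {t : ℝ} (ht : spectralRadius ℂ a < ENNReal.ofReal t) :
    ∀ᶠ m : ℕ in atTop, ‖a ^ m‖ ≤ t ^ m := by
  have ht0 : 0 < t := ENNReal.ofReal_pos.1 (lt_of_le_of_lt zero_le ht)
  filter_upwards [(spectrum.pow_norm_pow_one_div_tendsto_nhds_spectralRadius a).eventually_lt_const ht,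
    eventually_gt_atTop 0] with m hm hm0
  have h1 := (ENNReal.ofReal_lt_ofReal_iff ht0).1 hm
  have h2 : (‖a ^ m‖ ^ (1 / m : ℝ)) ^ m ≤ t ^ m := by gcongr
  rwa [one_div, Real.rpow_inv_natCast_pow (norm_nonneg _) hm0.ne'] at h2

/-- The factor `‖1‖` stays because the algebra of 0×0 matrices, where it vanishes, must be covered.
-/
lemma spectralRadius_pow_le_norm_pow {B : Type*} [NormedRing B] [NormedAlgebra ℂ B]
    [CompleteSpace B] (a : B) (m : ℕ) :
    (spectralRadius ℂ a).toReal ^ (m + 1) ≤ ‖a ^ (m + 1)‖ * ‖(1 : B)‖ := by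
  have h : spectralRadius ℂ a ^ (m + 1) ≤ (‖a ^ (m + 1)‖₊ * ‖(1 : B)‖₊ : ENNReal) := by
    refine (spectrum.spectralRadius_pow_le a (m + 1) (by simp)).trans ?_
    refine iSup₂_le fun k hk => ?_
    exact_mod_cast spectrum.norm_le_norm_mul_of_mem hk
  have h2 := ENNReal.toReal_mono (by finiteness) h
  simpa using h2

lemma spectralRadius_ne_top {B : Type*} [NormedRing B] [NormedAlgebra ℂ B]
    [CompleteSpace B] (a : B) : spectralRadius ℂ a ≠ ⊤ := by
  refine ne_top_of_le_ne_top (b := (‖a‖₊ * ‖(1 : B)‖₊ : ENNReal)) (by finiteness) ?_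
  refine iSup₂_le fun k hk => ?_
  exact_mod_cast spectrum.norm_le_norm_mul_of_mem hk

open scoped Matrix.Norms.Operator in
lemma norm_entry_le_norm {n : ℕ} (M : Matrix (Fin n) (Fin n) ℂ) (i j : Fin n) :
    ‖M i j‖ ≤ ‖M‖ := by
  have h : ‖M i j‖₊ ≤ ‖M‖₊ := by
    rw [Matrix.linfty_opNNNorm_def]
    exact (Finset.single_le_sum (f := fun k => ‖M i k‖₊) (fun _ _ => zero_le)
      (Finset.mem_univ j)).trans (Finset.le_sup (f := fun i => ∑ k, ‖M i k‖₊) (Finset.mem_univ i))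
  exact h

open scoped Matrix.Norms.Operator in
lemma norm_le_sum_norm_entry {n : ℕ} (M : Matrix (Fin n) (Fin n) ℂ) :
    ‖M‖ ≤ ∑ i, ∑ j, ‖M i j‖ := by
  have h : ‖M‖₊ ≤ ∑ i, ∑ j, ‖M i j‖₊ := by
    rw [Matrix.linfty_opNNNorm_def]
    exact Finset.sup_le fun i _ => Finset.single_le_sum (f := fun i => ∑ k, ‖M i k‖₊)
      (fun _ _ => zero_le) (Finset.mem_univ i)
  have h2 : ((‖M‖₊ : NNReal) : ℝ) ≤ ((∑ i, ∑ j, ‖M i j‖₊ : NNReal) : ℝ) := NNReal.coe_le_coe.2 h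
  simpa using h2

lemma map_ofReal_pow {n : ℕ} (M : Matrix (Fin n) (Fin n) ℝ) (m : ℕ) :
    (M.map (fun x : ℝ => (x : ℂ))) ^ m = (M ^ m).map (fun x : ℝ => (x : ℂ)) :=
  (map_pow (Complex.ofRealHom.mapMatrix) M m).symm

open Filter in
lemma eventually_abs_entry_pow_le {n : ℕ} (M : Matrix (Fin n) (Fin n) ℝ) {t : ℝ}
    (ht : spectralRadius ℂ (M.map (fun x : ℝ => (x : ℂ))) < ENNReal.ofReal t) :
    ∀ᶠ m : ℕ in atTop, ∀ i j, |(M ^ m) i j| ≤ t ^ m := by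
  open scoped Matrix.Norms.Operator in
  filter_upwards [eventually_norm_pow_le_of_spectralRadius_lt _ ht] with m hm i j
  have := (norm_entry_le_norm _ i j).trans hm
  simpa [map_ofReal_pow] using this

open Filter in
lemma eventually_abs_entry_pow_le_of_perronEigenvalue_lt {n : ℕ} (M : Matrix (Fin n) (Fin n) ℝ)
    {t : ℝ} (ht : perronEigenvalue M < t) :
    ∀ᶠ m : ℕ in atTop, ∀ i j, |(M ^ m) i j| ≤ t ^ m := by
  open scoped Matrix.Norms.Operator in
  refine eventually_abs_entry_pow_le M ?_
  rw [perronEigenvalue] at ht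
  exact (ENNReal.lt_ofReal_iff_toReal_lt (spectralRadius_ne_top _)).2 ht

lemma exists_perronEigenvalue_pow_le_sum {n : ℕ} (M : Matrix (Fin n) (Fin n) ℝ) :
    ∃ C : ℝ, 0 < C ∧ ∀ m : ℕ, perronEigenvalue M ^ (m + 1) ≤ C * ∑ i, ∑ j, |(M ^ (m + 1)) i j| := by
  open scoped Matrix.Norms.Operator in
  -- For `n = 0` the norm of `1` is zero; the added `1` keeps the constant positive.
  refine ⟨‖(1 : Matrix (Fin n) (Fin n) ℂ)‖ + 1, by positivity, fun m => ?_⟩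
  refine (spectralRadius_pow_le_norm_pow _ m).trans ?_
  rw [mul_comm]
  gcongr
  · simp
  · refine (norm_le_sum_norm_entry _).trans (le_of_eq ?_)
    simp [map_ofReal_pow]

lemma Matrix.pow_nonneg_entry {n : ℕ} {S : Matrix (Fin n) (Fin n) ℝ} (hS : ∀ i j, 0 ≤ S i j)
    (m : ℕ) (i j : Fin n) : 0 ≤ (S ^ m) i j := by
  induction m generalizing i j with
  | zero => by_cases h : i = j <;> simp [h]
  | succ m ih =>
    rw [pow_succ, Matrix.mul_apply]
    exact Finset.sum_nonneg fun k _ => mul_nonneg (ih i k) (hS k j)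

/-- Every entry of the powers of a primitive matrix grows at least like the powers of the
Perron eigenvalue. -/
lemma exists_const_mul_perronEigenvalue_pow_le {n : ℕ} {S : Matrix (Fin n) (Fin n) ℝ}
    (hS : S.IsPrimitive) (hpos : 0 < perronEigenvalue S) :
    ∃ c : ℝ, 0 < c ∧ ∃ K : ℕ, ∀ m ≥ K, ∀ k l, c * perronEigenvalue S ^ m ≤ (S ^ m) k l := by
  rcases isEmpty_or_nonempty (Fin n) with h0 | h0
  · exact ⟨1, one_pos, 0, fun _ _ k => (h0.false k).elim⟩
  obtain ⟨K, hK0, hK⟩ := hS.exists_pos_pow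
  have hnn := Matrix.pow_nonneg_entry hS.nonneg
  obtain ⟨C, hC0, hC⟩ := exists_perronEigenvalue_pow_le_sum S
  obtain ⟨p, -, hp⟩ := Finset.exists_min_image (Finset.univ : Finset (Fin n × Fin n))
    (fun p => (S ^ K) p.1 p.2) Finset.univ_nonempty
  set δ := (S ^ K) p.1 p.2 with hδ
  have hδ0 : 0 < δ := hK _ _
  set r := perronEigenvalue S
  -- Sandwiching `S ^ (m + 1)` between two copies of `S ^ K`, whose entries are at least `δ`, bounds
  -- each entry below by `δ ^ 2` times the sum of all entries of `S ^ (m + 1)`. The power `r ^ (2 *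
  -- K)` pays for the two extra factors.
  refine ⟨δ ^ 2 / (C * r ^ (2 * K)), by positivity, 2 * K + 1, fun m hm k l => ?_⟩
  obtain ⟨m, rfl⟩ := Nat.exists_eq_add_of_le hm
  have e : S ^ (2 * K + 1 + m) = S ^ K * S ^ (m + 1) * S ^ K := by
    rw [← pow_add, ← pow_add]; congr 1; ring
  have h1 : δ ^ 2 * ∑ i, ∑ j, |(S ^ (m + 1)) i j| ≤ (S ^ (2 * K + 1 + m)) k l := by
    rw [e, Matrix.mul_apply, Finset.sum_comm, Finset.mul_sum]
    refine Finset.sum_le_sum fun j _ => ?_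
    rw [Matrix.mul_apply, Finset.sum_mul, Finset.mul_sum]
    refine Finset.sum_le_sum fun i _ => ?_
    rw [abs_of_nonneg (hnn _ _ _)]
    have a := hp (k, i) (Finset.mem_univ _)
    have b := hp (j, l) (Finset.mem_univ _)
    have c := hnn (m + 1) i j
    calc δ ^ 2 * (S ^ (m + 1)) i j = δ * (S ^ (m + 1)) i j * δ := by ring
      _ ≤ _ := by
        gcongr
        exact mul_nonneg (hnn _ _ _) c
  refine le_trans ?_ h1
  have h2 := hC m
  rw [div_mul_eq_mul_div, div_le_iff₀ (by positivity)]
  calc δ ^ 2 * r ^ (2 * K + 1 + m) = δ ^ 2 * r ^ (2 * K) * r ^ (m + 1) := by ring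
    _ ≤ δ ^ 2 * r ^ (2 * K) * (C * ∑ i, ∑ j, |(S ^ (m + 1)) i j|) := by gcongr
    _ = _ := by ring

open Filter Topology in
/-- A positive vector cannot be expanded by a nonnegative matrix by more than the
Perron eigenvalue. -/
lemma le_perronEigenvalue_of_pos_vecMul {n : ℕ} [Nonempty (Fin n)] {S : Matrix (Fin n) (Fin n) ℝ}
    (hS : ∀ i j, 0 ≤ S i j) {w : Fin n → ℝ} (hw : ∀ i, 0 < w i) {θ : ℝ}
    (h : ∀ i, θ * w i ≤ ∑ j, w j * S j i) : θ ≤ perronEigenvalue S := by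
  by_contra! hlt
  obtain ⟨t, ht1, ht2⟩ := exists_between hlt
  have hr0 : 0 ≤ perronEigenvalue S := ENNReal.toReal_nonneg
  have ht0 : 0 < t := hr0.trans_lt ht1
  have hθ0 : 0 < θ := ht0.trans ht2
  have key : ∀ m : ℕ, ∀ i, θ ^ m * w i ≤ ∑ j, w j * (S ^ m) j i := by
    intro m
    induction m with
    | zero => intro i; simp [Matrix.one_apply]
    | succ m ih =>
      intro i
      calc θ ^ (m + 1) * w i = θ ^ m * (θ * w i) := by ring
        _ ≤ θ ^ m * ∑ j, w j * S j i := by gcongr; exact h i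
        _ = ∑ j, (θ ^ m * w j) * S j i := by rw [Finset.mul_sum]; congr! 1; ring
        _ ≤ ∑ j, (∑ k, w k * (S ^ m) k j) * S j i := by
          gcongr with j _
          · exact hS _ _
          · exact ih j
        _ = _ := by
          simp_rw [pow_succ, Matrix.mul_apply, Finset.sum_mul, Finset.mul_sum]
          rw [Finset.sum_comm]
          simp_rw [mul_assoc]
  obtain ⟨i⟩ := ‹Nonempty (Fin n)›
  -- The entries of `S ^ m` are eventually at most `t ^ m` with `t < θ`, which keeps an unbounded
  -- sequence bounded.
  have h1 : ∀ᶠ m : ℕ in atTop, (θ / t) ^ m * w i ≤ ∑ j, w j := by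
    filter_upwards [eventually_abs_entry_pow_le_of_perronEigenvalue_lt S ht1] with m hm
    rw [div_pow, div_mul_eq_mul_div, div_le_iff₀ (by positivity), Finset.sum_mul]
    refine (key m i).trans (Finset.sum_le_sum fun j _ => ?_)
    have := (le_abs_self _).trans (hm j i)
    have := (hw j).le
    gcongr
  have h2 : Tendsto (fun m : ℕ => (θ / t) ^ m * w i) atTop atTop :=
    (tendsto_pow_atTop_atTop_of_one_lt ((one_lt_div ht0).2 ht2)).atTop_mul_const (hw i)
  obtain ⟨m, hm1, hm2⟩ := (h1.and (h2.eventually_gt_atTop _)).exists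
  exact absurd hm1 (not_le.2 hm2)

/-- A nonnegative sub-eigenvector of a primitive matrix for its Perron eigenvalue is zero or
a positive eigenvector. -/
lemma eq_and_pos_of_perronEigenvalue_mul_le {n : ℕ} {S : Matrix (Fin n) (Fin n) ℝ}
    (hS : S.IsPrimitive) (hpos : 0 < perronEigenvalue S) {v : Fin n → ℝ} (hv : ∀ i, 0 ≤ v i)
    (hv0 : ∃ i, 0 < v i) (h : ∀ i, perronEigenvalue S * v i ≤ ∑ j, v j * S j i) :
    (∀ i, 0 < v i) ∧ ∀ m i, perronEigenvalue S ^ m * v i = ∑ j, v j * (S ^ m) j i := by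
  set r := perronEigenvalue S with hr
  obtain ⟨K, hK0, hK⟩ := hS.exists_pos_pow
  obtain ⟨i0, hi0⟩ := hv0
  have : Nonempty (Fin n) := ⟨i0⟩
  have heq : ∀ i, r * v i = ∑ j, v j * S j i := by
    by_contra! hne
    obtain ⟨i1, hi1⟩ := hne
    have hlt := lt_of_le_of_ne (h i1) hi1
    -- Applying the positive matrix `S ^ K` spreads strictness in the single coordinate `i1` to all
    -- coordinates.
    set w : Fin n → ℝ := fun i => ∑ j, v j * (S ^ K) j i with hw
    have hwpos : ∀ i, 0 < w i := fun i =>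
      Finset.sum_pos' (fun j _ => mul_nonneg (hv j) (hK j i).le)
        ⟨i0, Finset.mem_univ _, mul_pos hi0 (hK _ _)⟩
    have hstrict : ∀ i, r * w i < ∑ j, w j * S j i := by
      intro i
      have e : ∑ j, w j * S j i = ∑ j, (∑ k, v k * S k j) * (S ^ K) j i := by
        have hc : S ^ K * S = S * S ^ K := by rw [← pow_succ, pow_succ']
        calc ∑ j, w j * S j i = ∑ k, v k * (S ^ K * S) k i := by
              simp_rw [hw, Matrix.mul_apply, Finset.sum_mul, Finset.mul_sum]
              rw [Finset.sum_comm]; simp_rw [mul_assoc]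
          _ = _ := by
              simp_rw [hc, Matrix.mul_apply, Finset.sum_mul, Finset.mul_sum]
              rw [Finset.sum_comm]; simp_rw [mul_assoc]
      rw [e, hw, Finset.mul_sum]
      refine Finset.sum_lt_sum (fun j _ => ?_) ⟨i1, Finset.mem_univ _, ?_⟩
      · rw [← mul_assoc]
        exact mul_le_mul_of_nonneg_right (h j) (hK j i).le
      · rw [← mul_assoc]
        exact mul_lt_mul_of_pos_right hlt (hK i1 i)
    -- The smallest expansion ratio of `w` exceeds `r`, yet no positive vector is expanded by more
    -- than `r`.
    obtain ⟨p, -, hp⟩ := Finset.exists_min_image (Finset.univ : Finset (Fin n))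
      (fun i => (∑ j, w j * S j i) / w i) Finset.univ_nonempty
    have h1 : (∑ j, w j * S j p) / w p ≤ r :=
      le_perronEigenvalue_of_pos_vecMul hS.nonneg hwpos fun i => by
        have := hp i (Finset.mem_univ _)
        rwa [← le_div_iff₀ (hwpos i)]
    have h2 := hstrict p
    rw [div_le_iff₀ (hwpos p)] at h1
    exact absurd h1 (not_le.2 h2)
  have hpow : ∀ m i, r ^ m * v i = ∑ j, v j * (S ^ m) j i := by
    intro m
    induction m with
    | zero => intro i; simp [Matrix.one_apply]
    | succ m ih =>
      intro i
      calc r ^ (m + 1) * v i = r ^ m * (r * v i) := by ring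
        _ = ∑ j, (r ^ m * v j) * S j i := by
          rw [heq, Finset.mul_sum]; congr! 1; ring
        _ = _ := by
          simp_rw [ih, pow_succ, Matrix.mul_apply, Finset.sum_mul, Finset.mul_sum]
          rw [Finset.sum_comm]
          simp_rw [mul_assoc]
  refine ⟨fun i => ?_, hpow⟩
  have h3 : 0 < r ^ K * v i := by
    rw [hpow]
    exact Finset.sum_pos' (fun j _ => mul_nonneg (hv j) (hK j i).le)
        ⟨i0, Finset.mem_univ _, mul_pos hi0 (hK _ _)⟩
  exact pos_of_mul_pos_right h3 (by positivity)

/-! ### Expanding matrices -/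

lemma IsExpanding.det_ne_zero {d : ℕ} {A : Matrix (Fin d) (Fin d) ℝ} (hA : IsExpanding A) :
    A.det ≠ 0 := by
  intro h
  have : (0 : ℂ) ∈ spectrum ℂ (A.map (fun x : ℝ => (x : ℂ))) := by
    rw [spectrum.zero_mem_iff, Matrix.isUnit_iff_isUnit_det]
    have e : (A.map (fun x : ℝ => (x : ℂ))).det = ((A.det : ℝ) : ℂ) :=
      (Complex.ofRealHom.map_det A).symm
    simp [e, h]
  have := hA 0 this
  simp at this
  linarith

/-- The eigenvalues of `A⁻¹` are the inverses of those of `A`; compactness of the spectrum makes the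
bound strict for the supremum. Dimension zero is separate because the algebra is then trivial. -/
lemma IsExpanding.spectralRadius_inv_lt_one {d : ℕ} {A : Matrix (Fin d) (Fin d) ℝ}
    (hA : IsExpanding A) : spectralRadius ℂ (A⁻¹.map (fun x : ℝ => (x : ℂ))) < 1 := by
  open scoped Matrix.Norms.Operator in
  rcases Nat.eq_zero_or_pos d with rfl | hd
  · rw [spectrum.SpectralRadius.of_subsingleton]; exact one_pos
  have : Nonempty (Fin d) := ⟨⟨0, hd⟩⟩
  have hu : IsUnit A.det := hA.det_ne_zero.isUnit
  have h1 : A.map (fun x : ℝ => (x : ℂ)) * A⁻¹.map (fun x : ℝ => (x : ℂ)) = 1 := by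
    have := map_mul (Complex.ofRealHom.mapMatrix) A A⁻¹
    rw [Matrix.mul_nonsing_inv _ hu, map_one] at this
    exact this.symm
  have h2 : A⁻¹.map (fun x : ℝ => (x : ℂ)) * A.map (fun x : ℝ => (x : ℂ)) = 1 := by
    have := map_mul (Complex.ofRealHom.mapMatrix) A⁻¹ A
    rw [Matrix.nonsing_inv_mul _ hu, map_one] at this
    exact this.symm
  let u : (Matrix (Fin d) (Fin d) ℂ)ˣ := ⟨_, _, h1, h2⟩
  refine spectrum.spectralRadius_lt_of_forall_lt (r := 1) _ fun k hk => ?_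
  have hk0 : k ≠ 0 := by
    rintro rfl
    exact (spectrum.zero_mem_iff ℂ).1 hk (u⁻¹).isUnit
  have h3 : (((Units.mk0 k hk0)⁻¹ : ℂˣ) : ℂ) ∈ spectrum ℂ (u : Matrix (Fin d) (Fin d) ℂ) := by
    have h4 : ((Units.mk0 k hk0 : ℂˣ) : ℂ) ∈
      spectrum ℂ ((u⁻¹ : (Matrix (Fin d) (Fin d) ℂ)ˣ) : Matrix (Fin d) (Fin d) ℂ) := hk
    rw [spectrum.inv_mem_iff, inv_inv] at h4
    exact h4
  have h5 := hA _ h3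
  have h6 : 1 < ‖k‖⁻¹ := by simpa using h5
  have h7 : ‖k‖ < 1 := by
    rw [one_lt_inv₀ (by positivity)] at h6; exact h6
  exact_mod_cast h7

/-- The crude factor `d ^ 2` is harmless, since `b` will decay geometrically. -/
lemma norm_toEuclideanLin_le {d : ℕ} {B : Matrix (Fin d) (Fin d) ℝ} {b : ℝ} (hb0 : 0 ≤ b)
    (hb : ∀ i j, |B i j| ≤ b) (z : EuclideanSpace ℝ (Fin d)) :
    ‖Matrix.toEuclideanLin B z‖ ≤ d * (d * (b * ‖z‖)) := by
  have h1 : ∀ i, ‖Matrix.toEuclideanLin B z i‖ ≤ d * (b * ‖z‖) := by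
    intro i
    have e : Matrix.toEuclideanLin B z i = ∑ j, B i j * z j := rfl
    rw [e]
    refine (norm_sum_le _ _).trans ?_
    refine (Finset.sum_le_card_nsmul _ _ (b * ‖z‖) fun j _ => ?_).trans (by simp)
    rw [norm_mul]
    exact mul_le_mul (hb i j) (PiLp.norm_apply_le z j) (norm_nonneg _) hb0
  calc ‖Matrix.toEuclideanLin B z‖ ≤ ∑ i, ‖Matrix.toEuclideanLin B z i‖ := by
        rw [EuclideanSpace.norm_eq]
        refine Real.sqrt_le_iff.2 ⟨Finset.sum_nonneg fun i _ => norm_nonneg _, ?_⟩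
        exact Finset.sum_sq_le_sq_sum_of_nonneg fun i _ => norm_nonneg _
    _ ≤ d * (d * (b * ‖z‖)) := by
        refine (Finset.sum_le_card_nsmul _ _ (d * (b * ‖z‖)) fun i _ => h1 i).trans (by simp)

open Filter in
/-- High powers of an expanding matrix map small balls onto sets that contain large balls. -/
lemma IsExpanding.eventually_ball_subset_image {d : ℕ} {A : Matrix (Fin d) (Fin d) ℝ}
    (hA : IsExpanding A) {r : ℝ} (hr : 0 < r) (R : ℝ) :
    ∀ᶠ m : ℕ in atTop, ∀ x : EuclideanSpace ℝ (Fin d),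
      Metric.ball ((Matrix.toEuclideanLin A ^ m) x) R ⊆
        (Matrix.toEuclideanLin A ^ m) '' Metric.ball x r := by
  obtain ⟨t, ht0, ht⟩ := ENNReal.lt_iff_exists_real_btwn.1 hA.spectralRadius_inv_lt_one
  obtain ⟨ht1, ht2⟩ := ht
  have ht2' : t < 1 := by simpa using ht2
  have hlim : Tendsto (fun m : ℕ => (t ^ m) * (d * (d * |R|) + 1)) atTop (nhds 0) := by
    simpa using (tendsto_pow_atTop_nhds_zero_of_lt_one ht0 ht2').mul_const (d * (d * |R|) + 1)
  filter_upwards [eventually_abs_entry_pow_le _ ht1, hlim.eventually_lt_const hr] with m hm hmr x y hy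
  have hu : IsUnit (A ^ m).det := by rw [Matrix.det_pow]; exact hA.det_ne_zero.isUnit.pow m
  have hpow : Matrix.toEuclideanLin A ^ m = Matrix.toEuclideanLin (A ^ m) :=
    (Matrix.toLpLin_pow 2 A m).symm
  have hinv : ∀ z, Matrix.toEuclideanLin (A ^ m) (Matrix.toEuclideanLin ((A⁻¹) ^ m) z) = z := by
    intro z
    have := Matrix.toLpLin_mul_same 2 (A ^ m) ((A⁻¹) ^ m)
    rw [Matrix.inv_pow', Matrix.mul_nonsing_inv _ hu, Matrix.toLpLin_one] at this
    rw [Matrix.inv_pow']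
    exact (LinearMap.congr_fun this z).symm
  set z := y - (Matrix.toEuclideanLin A ^ m) x with hz
  -- This is the preimage of `y`; its distance to `x` is governed by the decay of `A⁻¹ ^ m`,
  -- uniformly in `x`.
  refine ⟨x + Matrix.toEuclideanLin ((A⁻¹) ^ m) z, ?_, ?_⟩
  · rw [Metric.mem_ball, dist_eq_norm, add_sub_cancel_left]
    have hzR : ‖z‖ ≤ |R| := by
      rw [hz, ← dist_eq_norm]; exact (Metric.mem_ball.1 hy).le.trans (le_abs_self R)
    calc ‖Matrix.toEuclideanLin ((A⁻¹) ^ m) z‖ ≤ d * (d * (t ^ m * ‖z‖)) :=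
          norm_toEuclideanLin_le (by positivity) hm z
      _ ≤ d * (d * (t ^ m * |R|)) := by gcongr
      _ = t ^ m * (d * (d * |R|)) := by ring
      _ ≤ t ^ m * (d * (d * |R|) + 1) := by gcongr; linarith
      _ < r := hmr
  · rw [hpow, map_add, hinv, hz, hpow]; abel

/-! ### Enumerations of multisets and iterated digit multisets -/

/-- An enumeration of a multiset, with multiplicities. -/
noncomputable def Multiset.enum {α : Type*} (X : Multiset α) : Fin X.toList.length → α := X.toList.get

lemma Multiset.map_enum {α : Type*} (X : Multiset α) :
    (Finset.univ : Finset (Fin X.toList.length)).val.map X.enum = X := by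
  conv_rhs => rw [← X.coe_toList]
  rw [Fin.univ_val_map, Multiset.enum, List.ofFn_get]

lemma Multiset.mem_iff_exists_enum {α : Type*} {X : Multiset α} {x : α} :
    x ∈ X ↔ ∃ a, X.enum a = x := by
  rw [Multiset.enum, ← Multiset.mem_toList, List.mem_iff_get]

lemma Multiset.enum_mem {α : Type*} (X : Multiset α) (a) : X.enum a ∈ X :=
  Multiset.mem_iff_exists_enum.2 ⟨a, rfl⟩

lemma Multiset.nodup_iff_injective_enum {α : Type*} {X : Multiset α} :
    X.Nodup ↔ Function.Injective X.enum := by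
  conv_lhs => rw [← X.map_enum]
  rw [Finset.nodup_map_iff_injOn]
  simp

open Classical in
lemma countIn_eq_card_enum {E : Type*} (X : Multiset E) (B : Set E) :
    countIn X B = (Finset.univ.filter fun a => X.enum a ∈ B).card := by
  rw [countIn]
  conv_lhs => rw [← X.map_enum]
  rw [Multiset.countP_map]
  rfl

section digits

variable {d n : ℕ} {A : Matrix (Fin d) (Fin d) ℝ}
  {D : Fin n → Fin n → Finset (EuclideanSpace ℝ (Fin d))}
  {T : Fin n → Set (EuclideanSpace ℝ (Fin d))}

/-- Counting with multiplicity is what makes this exact, so that Perron–Frobenius growth applies to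
the number of digits. -/
lemma card_digitMultiset (m : ℕ) (j i : Fin n) :
    ((digitMultiset A D m j i).card : ℝ) = (subdivisionMatrix D ^ m) j i := by
  induction m generalizing j with
  | zero => by_cases h : j = i <;> simp [digitMultiset, h]
  | succ m ih =>
    rw [pow_succ', Matrix.mul_apply, digitMultiset, Multiset.card_sum, Nat.cast_sum]
    refine Finset.sum_congr rfl fun k _ => ?_
    rw [← ih]
    simp [multisetSum, Multiset.card_bind, subdivisionMatrix, mul_comm]

lemma mem_digitMultiset_succ {m : ℕ} {j i : Fin n} {x : EuclideanSpace ℝ (Fin d)} :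
    x ∈ digitMultiset A D (m + 1) j i ↔
      ∃ k, ∃ a ∈ D j k, ∃ b ∈ digitMultiset A D m k i, a + Matrix.toEuclideanLin A b = x := by
  simp only [digitMultiset, Multiset.mem_sum, Finset.mem_univ, true_and, multisetSum,
    Multiset.mem_bind, Multiset.mem_map, Finset.mem_val]
  constructor
  · rintro ⟨k, _, ⟨b, hb, rfl⟩, a, ha, rfl⟩
    exact ⟨k, a, ha, b, hb, rfl⟩
  · rintro ⟨k, a, ha, b, hb, rfl⟩
    exact ⟨k, _, ⟨b, hb, rfl⟩, a, ha, rfl⟩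

/-- The iterated functional equation. One more application of `A` turns a tile `b + T k` into the
tiles `a + A b + T j` with `a ∈ D j k`, matching the recursion of `digitMultiset`. -/
lemma mem_image_pow_iff (hT : SatisfiesMultiTile A D T) (m : ℕ) (i : Fin n)
    (y : EuclideanSpace ℝ (Fin d)) :
    y ∈ (Matrix.toEuclideanLin A ^ m) '' T i ↔
      ∃ j, ∃ x ∈ digitMultiset A D m j i, ∃ q ∈ T j, x + q = y := by
  induction m generalizing y with
  | zero =>
    simp only [pow_zero, digitMultiset]
    constructor
    · rintro ⟨q, hq, rfl⟩
      exact ⟨i, 0, by simp, q, hq, by simp⟩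
    · rintro ⟨j, x, hx, q, hq, rfl⟩
      by_cases h : j = i
      · subst h
        simp only [if_true, Multiset.mem_singleton] at hx
        exact ⟨q, hq, by simp [hx]⟩
      · simp [h] at hx
  | succ m ih =>
    have e : (Matrix.toEuclideanLin A ^ (m + 1)) '' T i =
        Matrix.toEuclideanLin A '' ((Matrix.toEuclideanLin A ^ m) '' T i) := by
      rw [Set.image_image, pow_succ']; rfl
    have hT' : ∀ k z, z ∈ Matrix.toEuclideanLin A '' T k ↔ ∃ j, ∃ q ∈ T j, ∃ a ∈ D j k, q + a = z := by
      intro k z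
      rw [hT k]
      simp [Set.mem_add]
    rw [e]
    constructor
    · rintro ⟨z, hz, rfl⟩
      obtain ⟨k, b, hb, q, hq, rfl⟩ := (ih z).1 hz
      obtain ⟨j, q', hq', a, ha, h⟩ := (hT' k _).1 ⟨q, hq, rfl⟩
      refine ⟨j, _, mem_digitMultiset_succ.2 ⟨k, a, ha, b, hb, rfl⟩, q', hq', ?_⟩
      rw [map_add, ← h]; abel
    · rintro ⟨j, x, hx, q', hq', rfl⟩
      obtain ⟨k, a, ha, b, hb, rfl⟩ := mem_digitMultiset_succ.1 hx
      obtain ⟨q, hq, h⟩ := (hT' k (q' + a)).2 ⟨j, q', hq', a, ha, rfl⟩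
      refine ⟨b + q, (ih _).2 ⟨k, b, hb, q, hq, rfl⟩, ?_⟩
      rw [map_add, h]; abel

lemma exists_mem_digitMultiset_of_isPrimitive (A : Matrix (Fin d) (Fin d) ℝ)
    (hS : (subdivisionMatrix D).IsPrimitive) :
    ∃ K, ∀ j i, ∃ x, x ∈ digitMultiset A D K j i := by
  obtain ⟨K, -, hK⟩ := hS.exists_pos_pow
  refine ⟨K, fun j i => Multiset.card_pos_iff_exists_mem.1 ?_⟩
  have := hK j i
  rw [← card_digitMultiset (A := A)] at this
  exact_mod_cast this

lemma nonempty_of_isPrimitive (hS : (subdivisionMatrix D).IsPrimitive)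
    (hne : ∃ i, (T i).Nonempty) (hT : SatisfiesMultiTile A D T) (i : Fin n) : (T i).Nonempty := by
  obtain ⟨j, q, hq⟩ := hne
  obtain ⟨K, hK⟩ := exists_mem_digitMultiset_of_isPrimitive A hS
  obtain ⟨x, hx⟩ := hK j i
  obtain ⟨p, hp, -⟩ := (mem_image_pow_iff hT K i _).2 ⟨j, x, hx, q, hq, rfl⟩
  exact ⟨p, hp⟩

end digits

/-! ### Measures of finite families of sets -/

section measure

open MeasureTheory

open Classical in
-- The left side is the integral of the covering multiplicity, which is at most `M` on the union and
-- zero elsewhere.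
lemma sum_measure_le_of_card_le {α ι : Type*} [MeasurableSpace α] [Fintype ι] (μ : Measure α)
    {P : ι → Set α} (hP : ∀ a, MeasurableSet (P a)) {W : Set α}
    (hPW : ∀ a, P a ⊆ W)
    {M : ℕ} (hM : ∀ y, (Finset.univ.filter fun a => y ∈ P a).card ≤ M) :
    ∑ a, μ (P a) ≤ M * μ W := by
  refine le_trans ?_ (mul_le_mul_right (measure_mono (Set.iUnion_subset hPW)) _)
  have hW : MeasurableSet (⋃ a, P a) := MeasurableSet.iUnion hP
  have hPW := Set.subset_iUnion P
  set W := ⋃ a, P a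
  calc ∑ a, μ (P a) = ∫⁻ y, ∑ a, (P a).indicator 1 y ∂μ := by
        rw [lintegral_finsetSum _ fun a _ => measurable_one.indicator (hP a)]
        simp [hP]
    _ ≤ ∫⁻ y, W.indicator (fun _ => (M : ENNReal)) y ∂μ := by
        refine lintegral_mono fun y => ?_
        by_cases hy : y ∈ W
        · have : ∑ a, (P a).indicator (1 : α → ENNReal) y =
              ((Finset.univ.filter fun a => y ∈ P a).card : ENNReal) := by
            simp [Set.indicator_apply, Finset.sum_boole]
          simp only [this, Set.indicator_of_mem hy]
          exact_mod_cast hM y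
        · have : ∀ a, y ∉ P a := fun a h => hy (hPW a h)
          simp [this]
    _ = M * μ W := by rw [lintegral_indicator_const hW]

/-- If the measure of a finite union is the sum of the measures, the sets are essentially
disjoint. -/
lemma measure_inter_eq_zero_of_sum_le {α ι : Type*} [MeasurableSpace α] [Fintype ι] [DecidableEq ι]
    (μ : Measure α) {P : ι → Set α} (hP : ∀ a, MeasurableSet (P a)) (hfin : ∀ a, μ (P a) ≠ ⊤)
    (h : ∑ a, μ (P a) ≤ μ (⋃ a, P a)) {a b : ι} (hab : a ≠ b) : μ (P a ∩ P b) = 0 := by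
  have e1 : ∑ c, μ (P c) = μ (P a) + μ (P b) + ∑ c ∈ (Finset.univ.erase a).erase b, μ (P c) := by
    rw [add_assoc, Finset.add_sum_erase _ (fun c => μ (P c)) (by simp [hab.symm]),
      Finset.add_sum_erase _ (fun c => μ (P c)) (by simp)]
  -- Subadditivity for all sets but the pair: a positive overlap of the pair alone would already
  -- make the union too small.
  have e2 : μ (⋃ a, P a) ≤ μ (P a ∪ P b) + ∑ c ∈ (Finset.univ.erase a).erase b, μ (P c) := by
    refine (measure_mono ?_).trans ((measure_union_le _ _).trans
      (add_le_add_right (measure_biUnion_finset_le ((Finset.univ.erase a).erase b) P) _))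
    refine Set.iUnion_subset fun c => ?_
    by_cases hc : c = a
    · subst hc; exact fun _ h => Or.inl (Or.inl h)
    by_cases hc' : c = b
    · subst hc'; exact fun _ h => Or.inl (Or.inr h)
    exact fun _ h => Or.inr (Set.mem_biUnion (by simp [hc, hc']) h)
  rw [← measure_union_add_inter (P a) (hP b)] at e1
  have hs : ∑ c ∈ (Finset.univ.erase a).erase b, μ (P c) ≠ ⊤ := by
    simp [hfin]
  have hu : μ (P a ∪ P b) ≠ ⊤ :=
    ((measure_union_le _ _).trans_lt (ENNReal.add_lt_top.2 ⟨(hfin a).lt_top, (hfin b).lt_top⟩)).ne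
  have h3 := (e1.symm.le.trans h).trans e2
  rw [ENNReal.add_le_add_iff_right hs] at h3
  by_contra h0
  exact absurd h3 (not_le.2 (ENNReal.lt_add_right hu h0))

/-- As `z → 0` the part of `z + K` outside `K` has measure tending to zero, hence eventually below
`μ K = μ (z + K)`. -/
lemma exists_pos_forall_measure_inter_vadd_pos {E : Type*} [NormedAddCommGroup E]
    [NormedSpace ℝ E] [FiniteDimensional ℝ E] [MeasurableSpace E] [BorelSpace E] (μ : Measure E)
    [μ.IsAddHaarMeasure] {K : Set E} (hK : IsCompact K) (h0 : 0 < μ K) :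
    ∃ ε > 0, ∀ z : E, ‖z‖ < ε → 0 < μ ((z +ᵥ K) ∩ K) := by
  have h := (tendsto_measure_vadd_sdiff_isCompact_isClosed (μ := μ) hK hK.isClosed).eventually_lt_const h0
  obtain ⟨ε, hε, hball⟩ := Metric.eventually_nhds_iff.1 h
  refine ⟨ε, hε, fun z hz => pos_iff_ne_zero.2 fun hz0 => ?_⟩
  have h1 : μ ((z +ᵥ K) \ K) < μ K := hball (by simpa using hz)
  have h2 := measure_sdiff_add_inter (μ := μ) (z +ᵥ K) hK.measurableSet
  rw [hz0, add_zero, measure_vadd] at h2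
  exact h1.ne h2

end measure

/-! ### Packing and porosity -/

open MeasureTheory in
-- Volume packing: the balls of radius `ε / 2` around the points are disjoint and lie in a ball of
-- radius `R + ε`.
lemma exists_countIn_ball_le {d : ℕ} {ε : ℝ} (hε : 0 < ε) (R : ℝ) :
    ∃ N : ℕ, ∀ X : Multiset (EuclideanSpace ℝ (Fin d)), X.Nodup →
      (∀ x ∈ X, ∀ y ∈ X, x ≠ y → ε ≤ dist x y) → ∀ c, countIn X (Metric.ball c R) ≤ N := by
  classical
  set β := volume (Metric.ball (0 : EuclideanSpace ℝ (Fin d)) (ε / 2)) with hβ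
  have hβ0 : β ≠ 0 := (Metric.measure_ball_pos volume _ (by positivity)).ne'
  have hβt : β ≠ ⊤ := measure_ball_lt_top.ne
  set V := volume (Metric.ball (0 : EuclideanSpace ℝ (Fin d)) (R + ε)) with hV
  have hVt : V / β ≠ ⊤ := (ENNReal.div_lt_top measure_ball_lt_top.ne hβ0).ne
  obtain ⟨N, hN⟩ := ENNReal.exists_nat_gt hVt
  refine ⟨N, fun X hX hsep c => ?_⟩
  rw [countIn_eq_card_enum]
  set F := Finset.univ.filter fun a => X.enum a ∈ Metric.ball c R with hF
  have hdisj : Set.PairwiseDisjoint (F : Set _) fun a => Metric.ball (X.enum a) (ε / 2) := by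
    intro a _ b _ hab
    refine Metric.ball_disjoint_ball ?_
    have := hsep _ (X.enum_mem a) _ (X.enum_mem b)
      ((Multiset.nodup_iff_injective_enum.1 hX).ne hab)
    linarith
  have h1 : (F.card : ENNReal) * β ≤ V := by
    calc (F.card : ENNReal) * β = ∑ a ∈ F, volume (Metric.ball (X.enum a) (ε / 2)) := by
          simp [hβ, Measure.addHaar_ball_center volume _ (ε / 2)]
      _ = volume (⋃ a ∈ F, Metric.ball (X.enum a) (ε / 2)) :=
          (measure_biUnion_finset hdisj fun _ _ => measurableSet_ball).symm
      _ ≤ volume (Metric.ball c (R + ε)) := by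
          refine measure_mono (Set.iUnion₂_subset fun a ha => ?_)
          refine Metric.ball_subset_ball' ?_
          have := (Finset.mem_filter.1 ha).2
          rw [Metric.mem_ball] at this
          linarith
      _ = V := Measure.addHaar_ball_center volume _ _
  have h2 : (F.card : ENNReal) ≤ V / β := (ENNReal.le_div_iff_mul_le (Or.inl hβ0) (Or.inl hβt)).2 h1
  exact_mod_cast (h2.trans_lt hN).le

/-- Each ball contains a ball of a controlled radius that avoids a given nowhere dense
compact set. -/
lemma exists_ball_subset_ball_disjoint {E : Type*} [NormedAddCommGroup E] [ProperSpace E] {K : Set E}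
    (hK : IsCompact K) (hint : interior K = ∅) {r : ℝ} (hr : 0 < r) :
    ∃ s, 0 < s ∧ ∀ c, ∃ c', Metric.ball c' s ⊆ Metric.ball c r ∧ Disjoint (Metric.ball c' s) K := by
  have key : ∀ c : E, ∃ c', ∃ s, 0 < s ∧ Metric.ball c' s ⊆ Metric.ball c (r / 2) ∧
      Disjoint (Metric.ball c' s) K := by
    intro c
    have hne : (Metric.ball c (r / 2) \ K).Nonempty := by
      by_contra h
      rw [Set.not_nonempty_iff_eq_empty, Set.sdiff_eq_empty] at h
      have h1 := interior_maximal h Metric.isOpen_ball (Metric.mem_ball_self (half_pos hr))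
      simp [hint] at h1
    obtain ⟨c', hc'⟩ := hne
    obtain ⟨s, hs, hss⟩ := Metric.isOpen_iff.1 (Metric.isOpen_ball.sdiff hK.isClosed) c' hc'
    exact ⟨c', s, hs, hss.trans Set.sdiff_subset,
      Set.disjoint_left.2 fun x hx => (hss hx).2⟩
  choose f s hs hsub hdis using key
  -- Finitely many centres serve all `c` near `K`, which makes the radius uniform; for the other `c`
  -- the ball around `c` itself misses `K`. Radius `r / 2` leaves room to move from `c` to a chosen
  -- centre.
  obtain ⟨t, ht⟩ := (hK.cthickening (r := r)).elim_finite_subcover (fun c : E => Metric.ball c (r / 2))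
    (fun c => Metric.isOpen_ball) (fun c _ => Set.mem_iUnion.2 ⟨c, Metric.mem_ball_self (half_pos hr)⟩)
  obtain ⟨s0, hs0, hs0'⟩ : ∃ s0, 0 < s0 ∧ ∀ c ∈ t, s0 ≤ s c := by
    rcases t.eq_empty_or_nonempty with rfl | hne
    · exact ⟨1, one_pos, by simp⟩
    · obtain ⟨c, -, hc⟩ := t.exists_min_image s hne
      exact ⟨s c, hs c, hc⟩
  refine ⟨min s0 r, lt_min hs0 hr, fun c => ?_⟩
  by_cases hc : c ∈ Metric.cthickening r K
  · obtain ⟨e, he, hce⟩ := Set.mem_iUnion₂.1 (ht hc)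
    refine ⟨f e, ?_, ?_⟩
    · refine (Metric.ball_subset_ball ((min_le_left _ _).trans (hs0' e he))).trans
        ((hsub e).trans (Metric.ball_subset_ball' ?_))
      rw [Metric.mem_ball, dist_comm] at hce
      linarith
    · exact (hdis e).mono_left (Metric.ball_subset_ball ((min_le_left _ _).trans (hs0' e he)))
  · refine ⟨c, Metric.ball_subset_ball (min_le_right _ _), ?_⟩
    refine Set.disjoint_left.2 fun x hx hxK => hc ?_
    refine Metric.mem_cthickening_of_dist_le c x r K hxK ?_
    rw [dist_comm]
    exact (Metric.mem_ball.1 hx).le.trans (min_le_right _ _)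

/-- Each ball contains a ball of a controlled radius that avoids a bounded number of translates
of given nowhere dense compact sets. -/
lemma exists_ball_subset_ball_disjoint_list {E ι : Type*} [Finite ι] [NormedAddCommGroup E]
    [ProperSpace E] {K : ι → Set E}
    (hK : ∀ j, IsCompact (K j)) (hint : ∀ j, interior (K j) = ∅) (N : ℕ) {r : ℝ} (hr : 0 < r) :
    ∃ s, 0 < s ∧ ∀ l : List (ι × E), l.length ≤ N → ∀ c, ∃ c', Metric.ball c' s ⊆ Metric.ball c r ∧
      ∀ p ∈ l, Disjoint (Metric.ball c' s) (p.2 +ᵥ K p.1) := by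
  induction N generalizing r with
  | zero =>
    refine ⟨r, hr, fun l hl c => ⟨c, subset_rfl, ?_⟩⟩
    simp [List.length_eq_zero_iff.1 (Nat.le_zero.1 hl)]
  | succ N ih =>
    have h1 : ∃ s, 0 < s ∧ ∀ j c, ∃ c', Metric.ball c' s ⊆ Metric.ball c r ∧
        Disjoint (Metric.ball c' s) (K j) := by
      choose s hs hc using fun j => exists_ball_subset_ball_disjoint (hK j) (hint j) hr
      rcases isEmpty_or_nonempty ι with h | h
      · exact ⟨1, one_pos, fun j => (h.false j).elim⟩
      obtain ⟨j0, hj0⟩ := Finite.exists_min s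
      refine ⟨s j0, hs j0, fun j c => ?_⟩
      obtain ⟨c', h1, h2⟩ := hc j c
      have := Metric.ball_subset_ball (x := c') (hj0 j)
      exact ⟨c', this.trans h1, h2.mono_left this⟩
    obtain ⟨s1, hs1, H1⟩ := h1
    obtain ⟨s, hs, H⟩ := ih hs1
    -- The bound by `r` is needed for the empty list; otherwise the first set is avoided by a ball
    -- of radius `s1`, and the remaining ones inside that ball.
    refine ⟨min s r, lt_min hs hr, fun l hl c => ?_⟩
    cases l with
    | nil =>
      exact ⟨c, Metric.ball_subset_ball (min_le_right _ _), by simp⟩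
    | cons p l =>
      obtain ⟨c1, h1, h2⟩ := H1 p.1 (c - p.2)
      obtain ⟨c2, h3, h4⟩ := H l (by simpa using hl) (c1 + p.2)
      have hb := Metric.ball_subset_ball (x := c2) (min_le_left s r)
      have hmem : ∀ {x}, x ∈ Metric.ball c2 s → x - p.2 ∈ Metric.ball c1 s1 := by
        intro x hx
        have := h3 hx
        rw [Metric.mem_ball, dist_eq_norm] at this ⊢
        convert this using 2; abel
      refine ⟨c2, fun x hx => ?_, ?_⟩
      · have := h1 (hmem (hb hx))
        rw [Metric.mem_ball, dist_eq_norm] at this ⊢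
        convert this using 2; abel
      · intro q hq
        rcases List.mem_cons.1 hq with rfl | hq
        · refine Set.disjoint_left.2 fun x hx hxK => ?_
          obtain ⟨k, hk, rfl⟩ := hxK
          refine Set.disjoint_left.1 h2 (hmem (hb hx)) ?_
          simpa using hk
        · exact (h4 q hq).mono_left hb

open MeasureTheory

/-! ### Linear images of tiles and the counting bound -/

section tiles

variable {d n : ℕ} {A : Matrix (Fin d) (Fin d) ℝ}
  {D : Fin n → Fin n → Finset (EuclideanSpace ℝ (Fin d))}
  {T : Fin n → Set (EuclideanSpace ℝ (Fin d))}

lemma det_toEuclideanLin (A : Matrix (Fin d) (Fin d) ℝ) :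
    LinearMap.det (Matrix.toEuclideanLin A) = A.det :=
  LinearMap.det_toLin (PiLp.basisFun 2 ℝ (Fin d)) A

lemma volume_image_toEuclideanLin_pow (A : Matrix (Fin d) (Fin d) ℝ) (m : ℕ)
    (s : Set (EuclideanSpace ℝ (Fin d))) :
    volume ((Matrix.toEuclideanLin A ^ m) '' s) = ENNReal.ofReal (|A.det| ^ m) * volume s := by
  rw [Measure.addHaar_image_linearMap, map_pow, det_toEuclideanLin, abs_pow]

lemma IsExpanding.bijective_pow (hA : IsExpanding A) (m : ℕ) :
    Function.Bijective (Matrix.toEuclideanLin A ^ m) := by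
  have hu : IsUnit (Matrix.toEuclideanLin A ^ m) := by
    refine IsUnit.pow m ?_
    rw [LinearMap.isUnit_iff_isUnit_det, det_toEuclideanLin]
    exact hA.det_ne_zero.isUnit
  exact (Module.End.isUnit_iff _).1 hu

lemma continuous_toEuclideanLin_pow (A : Matrix (Fin d) (Fin d) ℝ) (m : ℕ) :
    Continuous (Matrix.toEuclideanLin A ^ m) :=
  LinearMap.continuous_of_finiteDimensional _

open Filter in
lemma IsExpanding.eventually_ball_subset_image_of_isCompact (hA : IsExpanding A)
    {K U : Set (EuclideanSpace ℝ (Fin d))} (hK : IsCompact K) (hU : IsOpen U) (hKU : K ⊆ U) :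
    ∀ᶠ m : ℕ in atTop, ∀ p ∈ K, Metric.ball ((Matrix.toEuclideanLin A ^ m) p) 1 ⊆
      (Matrix.toEuclideanLin A ^ m) '' U := by
  obtain ⟨δ, hδ, hδU⟩ := hK.exists_thickening_subset_open hU hKU
  filter_upwards [hA.eventually_ball_subset_image hδ 1] with m hm p hp
  exact (hm p).trans (Set.image_mono ((Metric.ball_subset_thickening hp δ).trans hδU))

/-- If the digit multisets have bounded density and disjoint from each other, up to bounded
multiplicity, there are equal balls near all the digits inside the image of `W`, then the volume of
`W` is bounded below. -/
lemma exists_const_mul_volume_ball_le (hA : IsExpanding A) (hS : (subdivisionMatrix D).IsPrimitive)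
    (hPerron : perronEigenvalue (subdivisionMatrix D) = |A.det|) :
    ∃ c : ENNReal, c ≠ 0 ∧ ∃ K : ℕ, ∀ m ≥ K, ∀ k l : Fin n, ∀ M : ℕ,
      (∀ y, countIn (digitMultiset A D m k l) (Metric.ball y 1) ≤ M) →
      ∀ (t : EuclideanSpace ℝ (Fin d)) (s : ℝ) (W : Set (EuclideanSpace ℝ (Fin d))),
      (∀ x ∈ digitMultiset A D m k l, ∃ y, Metric.ball y s ⊆ Metric.ball (x + t) 1 ∧
        Metric.ball y s ⊆ (Matrix.toEuclideanLin A ^ m) '' W) →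
      c * volume (Metric.ball (0 : EuclideanSpace ℝ (Fin d)) s) ≤ M * volume W := by
  classical
  have hdet : 0 < |A.det| := abs_pos.2 hA.det_ne_zero
  obtain ⟨c, hc, K, hK⟩ := exists_const_mul_perronEigenvalue_pow_le hS (hPerron ▸ hdet)
  refine ⟨ENNReal.ofReal c, (ENNReal.ofReal_pos.2 hc).ne', K, ?_⟩
  intro m hm k l M hM t s W hW
  choose! y hy1 hy2 using hW
  set X := digitMultiset A D m k l with hX
  have h1 := sum_measure_le_of_card_le volume (P := fun a => Metric.ball (y (X.enum a)) s)
    -- A point `z` in the ball chosen for `x` is within `1` of `x + t`, so `x` lies in the unit ball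
    -- about `z - t`, which holds at most `M` digits.
    (fun a => measurableSet_ball) (fun a => hy2 _ (X.enum_mem a)) (M := M) (fun z => by
      refine le_trans (Finset.card_le_card ?_) ((countIn_eq_card_enum X _).symm.le.trans (hM (z - t)))
      intro a ha
      simp only [Finset.mem_filter, Finset.mem_univ, true_and] at ha ⊢
      have := hy1 _ (X.enum_mem a) ha
      rw [Metric.mem_ball, dist_comm, dist_eq_norm] at this
      rw [Metric.mem_ball, dist_eq_norm]
      convert this using 2; abel)
  simp only [Measure.addHaar_ball_center volume _ s, Finset.sum_const, Finset.card_univ,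
    Fintype.card_fin, nsmul_eq_mul, Multiset.length_toList, volume_image_toEuclideanLin_pow] at h1
  -- The growth of the number of digits cancels the volume factor of `A ^ m`.
  have h2 : ENNReal.ofReal (|A.det| ^ m) * ENNReal.ofReal c ≤ (X.card : ENNReal) := by
    rw [← ENNReal.ofReal_mul (by positivity), ← ENNReal.ofReal_natCast, hX, card_digitMultiset, mul_comm,
      ← hPerron]
    exact ENNReal.ofReal_le_ofReal (hK m hm k l)
  have h3 : ENNReal.ofReal (|A.det| ^ m) * (ENNReal.ofReal c * volume (Metric.ball (0 : EuclideanSpace ℝ (Fin d)) s)) ≤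
      ENNReal.ofReal (|A.det| ^ m) * (M * volume W) := by
    rw [← mul_assoc, mul_left_comm _ (M : ENNReal)]
    exact (mul_le_mul_left h2 _).trans h1
  rwa [ENNReal.mul_le_mul_iff_right (by simpa using fun h => absurd h hA.det_ne_zero) ENNReal.ofReal_ne_top] at h3

/-! ### Bounded density of the digits implies positive measure -/

lemma volume_pos_of_weaklyEquiUniformlyDiscrete (hA : IsExpanding A)
    (hS : (subdivisionMatrix D).IsPrimitive)
    (hPerron : perronEigenvalue (subdivisionMatrix D) = |A.det|)
    (hcompact : ∀ i, IsCompact (T i)) (hne : ∃ i, (T i).Nonempty) (hT : SatisfiesMultiTile A D T)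
    {k l : Fin n} (h : WeaklyEquiUniformlyDiscrete fun m : ℕ+ => digitMultiset A D m k l) :
    0 < volume (T l) := by
  obtain ⟨M, hM⟩ := h
  obtain ⟨c, hc, K, hK⟩ := exists_const_mul_volume_ball_le hA hS hPerron
  set β := volume (Metric.ball (0 : EuclideanSpace ℝ (Fin d)) 1) with hβ
  have hβ0 : β ≠ 0 := (Metric.measure_ball_pos volume _ one_pos).ne'
  refine pos_iff_ne_zero.2 fun h0 => ?_
  obtain ⟨t, ht⟩ := nonempty_of_isPrimitive hS hne hT k
  -- `M + 1` avoids a zero denominator.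
  have hδ : 0 < c * β / (M + 1) :=
    ENNReal.div_pos (mul_ne_zero hc hβ0) (by finiteness)
  obtain ⟨U, hTU, hU, hUδ⟩ := (T l).exists_isOpen_lt_of_lt _ (h0 ▸ hδ)
  obtain ⟨m, hm, hmK⟩ := ((hA.eventually_ball_subset_image_of_isCompact (hcompact l) hU hTU).and
    -- The extra `1` makes `m` positive, as the index type `ℕ+` requires.
    (Filter.eventually_ge_atTop (K + 1))).exists
  have h1 := hK m (by omega) k l M (fun y => hM ⟨m, by omega⟩ y) t 1 U fun x hx => by
    obtain ⟨p, hp, hpx⟩ := (mem_image_pow_iff hT m l _).2 ⟨k, x, hx, t, ht, rfl⟩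
    exact ⟨x + t, subset_rfl, hpx ▸ hm p hp⟩
  have h2 : (M + 1) * volume U < c * β := by
    rw [mul_comm]; exact (ENNReal.lt_div_iff_mul_lt (by simp) (by simp)).1 hUδ
  have h3 : (M : ENNReal) * volume U ≤ (M + 1) * volume U := by gcongr; simp
  exact absurd (h1.trans h3) (not_le.2 h2)

/-! ### Measures of tiles -/

lemma sum_tiles_eq (v : Fin n → ℝ) (m : ℕ) (i : Fin n) :
    ∑ a : (Σ j, Fin (digitMultiset A D m j i).toList.length), v a.1 =
      ∑ j, v j * (subdivisionMatrix D ^ m) j i := by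
  rw [Fintype.sum_sigma]
  simp [← card_digitMultiset (A := A), mul_comm]

/-- General `B` covers both tiles and frontiers; general `F` allows a tile to be left out. -/
lemma pow_mul_volume_le_sum {B : Fin n → Set (EuclideanSpace ℝ (Fin d))}
    (hB : ∀ j, volume (B j) ≠ ⊤) {m : ℕ} {i : Fin n}
    {F : Finset (Σ j, Fin (digitMultiset A D m j i).toList.length)}
    (h : (Matrix.toEuclideanLin A ^ m) '' B i ⊆
      ⋃ a ∈ F, (digitMultiset A D m a.1 i).enum a.2 +ᵥ B a.1) :
    |A.det| ^ m * (volume (B i)).toReal ≤ ∑ a ∈ F, (volume (B a.1)).toReal := by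
  have h1 := (measure_mono (μ := volume) h).trans (measure_biUnion_finset_le F _)
  simp only [measure_vadd, volume_image_toEuclideanLin_pow] at h1
  have h2 := ENNReal.toReal_mono (by simp [hB]) h1
  rw [ENNReal.toReal_mul, ENNReal.toReal_ofReal (by positivity),
    ENNReal.toReal_sum fun a _ => hB _] at h2
  exact h2

lemma image_pow_eq_iUnion_tiles (hT : SatisfiesMultiTile A D T) (m : ℕ) (i : Fin n) :
    (Matrix.toEuclideanLin A ^ m) '' T i =
      ⋃ a : (Σ j, Fin (digitMultiset A D m j i).toList.length),
        (digitMultiset A D m a.1 i).enum a.2 +ᵥ T a.1 := by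
  ext y
  rw [mem_image_pow_iff hT, Set.mem_iUnion]
  constructor
  · rintro ⟨j, x, hx, q, hq, rfl⟩
    obtain ⟨a, rfl⟩ := Multiset.mem_iff_exists_enum.1 hx
    exact ⟨⟨j, a⟩, q, hq, rfl⟩
  · rintro ⟨⟨j, a⟩, q, hq, rfl⟩
    exact ⟨j, _, Multiset.enum_mem _ a, q, hq, rfl⟩

/-- The Perron–Frobenius alternative for the volumes of compact sets which are subdivided
according to the digit sets. -/
lemma volume_pos_and_pow_mul_volume_eq (hA : IsExpanding A)
    (hS : (subdivisionMatrix D).IsPrimitive)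
    (hPerron : perronEigenvalue (subdivisionMatrix D) = |A.det|)
    {B : Fin n → Set (EuclideanSpace ℝ (Fin d))} (hB : ∀ j, volume (B j) ≠ ⊤)
    (hsub : ∀ i, ⇑(Matrix.toEuclideanLin A ^ 1) '' B i ⊆
      ⋃ a : (Σ j, Fin (digitMultiset A D 1 j i).toList.length),
        (digitMultiset A D 1 a.1 i).enum a.2 +ᵥ B a.1)
    (hpos : ∃ j, 0 < volume (B j)) :
    (∀ j, 0 < volume (B j)) ∧ ∀ m i, |A.det| ^ m * (volume (B i)).toReal =
      ∑ a : (Σ j, Fin (digitMultiset A D m j i).toList.length), (volume (B a.1)).toReal := by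
  have hdet : 0 < |A.det| := abs_pos.2 hA.det_ne_zero
  obtain ⟨j, hj⟩ := hpos
  -- The first-level inclusion makes the volumes a sub-eigenvector; equality at every level `m` then
  -- comes for free.
  obtain ⟨h1, h2⟩ := eq_and_pos_of_perronEigenvalue_mul_le hS (hPerron ▸ hdet)
    (v := fun j => (volume (B j)).toReal) (fun _ => ENNReal.toReal_nonneg)
    ⟨j, ENNReal.toReal_pos hj.ne' (hB j)⟩ (fun i => by
      have := pow_mul_volume_le_sum (F := Finset.univ) hB
        (by simpa only [Finset.mem_univ, Set.iUnion_true] using hsub i)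
      rw [sum_tiles_eq fun j => (volume (B j)).toReal] at this
      simpa [hPerron] using this)
  refine ⟨fun j => (ENNReal.toReal_pos_iff.1 (h1 j)).1, fun m i => ?_⟩
  rw [← hPerron, h2, sum_tiles_eq fun j => (volume (B j)).toReal]

/-- The volumes of the tiles add up exactly to that of `A ^ m (T i)`, leaving no room for overlap.
-/
lemma volume_tile_inter_tile_eq_zero (hA : IsExpanding A)
    (hS : (subdivisionMatrix D).IsPrimitive)
    (hPerron : perronEigenvalue (subdivisionMatrix D) = |A.det|)
    (hcompact : ∀ i, IsCompact (T i)) (hT : SatisfiesMultiTile A D T)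
    (hpos : ∃ j, 0 < volume (T j)) (m : ℕ) (i : Fin n)
    {a b : Σ j, Fin (digitMultiset A D m j i).toList.length} (hab : a ≠ b) :
    volume (((digitMultiset A D m a.1 i).enum a.2 +ᵥ T a.1) ∩
      ((digitMultiset A D m b.1 i).enum b.2 +ᵥ T b.1)) = 0 := by
  classical
  have hfin : ∀ j, volume (T j) ≠ ⊤ := fun j => (hcompact j).measure_ne_top
  have h1 := (volume_pos_and_pow_mul_volume_eq hA hS hPerron hfin
    (fun i => (image_pow_eq_iUnion_tiles hT 1 i).subset) hpos).2 m i
  refine measure_inter_eq_zero_of_sum_le volume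
    (P := fun a : (Σ j, Fin (digitMultiset A D m j i).toList.length) =>
      (digitMultiset A D m a.1 i).enum a.2 +ᵥ T a.1)
    (fun a => ((hcompact _).vadd _).measurableSet) (fun a => by simpa using hfin a.1) ?_ hab
  rw [← image_pow_eq_iUnion_tiles hT m i, volume_image_toEuclideanLin_pow]
  simp only [measure_vadd]
  refine (ENNReal.toReal_le_toReal (by simp [hfin])
    (ENNReal.mul_ne_top ENNReal.ofReal_ne_top (hfin i))).1 ?_
  rw [ENNReal.toReal_mul, ENNReal.toReal_ofReal (by positivity),
    ENNReal.toReal_sum fun a _ => hfin _]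
  exact h1.symm.le

/-! ### Positive measure implies separation of the digits -/

lemma exists_separation_of_volume_pos (hA : IsExpanding A)
    (hS : (subdivisionMatrix D).IsPrimitive)
    (hPerron : perronEigenvalue (subdivisionMatrix D) = |A.det|)
    (hcompact : ∀ i, IsCompact (T i)) (hT : SatisfiesMultiTile A D T)
    (hpos : ∃ j, 0 < volume (T j)) :
    ∃ ε > 0, ∀ m j i, (digitMultiset A D m j i).Nodup ∧
      ∀ x ∈ digitMultiset A D m j i, ∀ y ∈ digitMultiset A D m j i, x ≠ y → ε ≤ dist x y := by
  have hpos' := (volume_pos_and_pow_mul_volume_eq hA hS hPerron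
    (fun j => (hcompact j).measure_ne_top)
    (fun i => (image_pow_eq_iUnion_tiles hT 1 i).subset) hpos).1
  choose e he hover using fun j =>
    exists_pos_forall_measure_inter_vadd_pos volume (hcompact j) (hpos' j)
  obtain ⟨j1, -⟩ := hpos
  have : Nonempty (Fin n) := ⟨j1⟩
  obtain ⟨j0, hj0⟩ := Finite.exists_min e
  -- Separating indices rather than points rules out repeated digits as well. The bound does not
  -- depend on `m` because the tiles `T j` are not rescaled.
  have key : ∀ m j i a b, a ≠ b →
      e j0 ≤ dist ((digitMultiset A D m j i).enum a) ((digitMultiset A D m j i).enum b) := by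
    intro m j i a b hab
    by_contra! hlt
    set x := (digitMultiset A D m j i).enum a
    set y := (digitMultiset A D m j i).enum b
    have h0 := volume_tile_inter_tile_eq_zero hA hS hPerron hcompact hT ⟨j1, hpos' j1⟩ m i
      (a := ⟨j, a⟩) (b := ⟨j, b⟩) (by simpa using hab)
    have h1 := hover j (x - y) (by rw [← dist_eq_norm]; exact hlt.trans_le (hj0 j))
    rw [← measure_vadd volume y, Set.vadd_set_inter, vadd_vadd, add_sub_cancel] at h1
    exact h1.ne' h0
  refine ⟨e j0, he j0, fun m j i => ⟨?_, ?_⟩⟩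
  · rw [Multiset.nodup_iff_injective_enum]
    intro a b hab
    by_contra hne
    have := key m j i a b hne
    rw [hab, dist_self] at this
    exact absurd this (not_le.2 (he j0))
  · intro x hx y hy hxy
    obtain ⟨a, rfl⟩ := Multiset.mem_iff_exists_enum.1 hx
    obtain ⟨b, rfl⟩ := Multiset.mem_iff_exists_enum.1 hy
    exact key m j i a b fun h => hxy (by rw [h])

lemma uniformlyDiscrete_of_nodup_of_le_dist {E : Type*} [PseudoMetricSpace E] {X : Multiset E}
    (hX : X.Nodup) {ε : ℝ} (hε : 0 < ε) (hsep : ∀ x ∈ X, ∀ y ∈ X, x ≠ y → ε ≤ dist x y) :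
    UniformlyDiscrete X := by
  classical
  refine ⟨ε / 2, by positivity, fun c => ?_⟩
  rw [countIn_eq_card_enum, Finset.card_le_one]
  intro a ha b hb
  by_contra hab
  have h1 := (Finset.mem_filter.1 ha).2
  have h2 := (Finset.mem_filter.1 hb).2
  rw [Metric.mem_ball] at h1 h2
  have h3 := hsep _ (X.enum_mem a) _ (X.enum_mem b)
    ((Multiset.nodup_iff_injective_enum.1 hX).ne hab)
  have := dist_triangle_right (X.enum a) (X.enum b) c
  linarith

lemma EquiUniformlyDiscrete.weakly {ι : Type*} {X : ι → Multiset (EuclideanSpace ℝ (Fin d))}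
    (hX : ∀ a, (X a).Nodup) (h : EquiUniformlyDiscrete X) : WeaklyEquiUniformlyDiscrete X := by
  obtain ⟨ε, hε, h⟩ := h
  obtain ⟨N, hN⟩ := exists_countIn_ball_le (d := d) hε 1
  exact ⟨N, fun a => hN _ (hX a) (h a).2⟩

/-! ### Interiors of the tiles -/

/-- The preimage of the open set `x + interior (T j)` under `A ^ m` is open and contained in `T i`.
-/
lemma mem_interior_of_pow_apply_eq (hA : IsExpanding A) (hT : SatisfiesMultiTile A D T) {m : ℕ}
    {i j : Fin n} {x q u : EuclideanSpace ℝ (Fin d)} (hx : x ∈ digitMultiset A D m j i)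
    (hq : q ∈ interior (T j)) (hu : (Matrix.toEuclideanLin A ^ m) u = x + q) :
    u ∈ interior (T i) := by
  refine mem_interior.2 ⟨(Matrix.toEuclideanLin A ^ m) ⁻¹' (x +ᵥ interior (T j)), ?_,
    (isOpen_interior.vadd x).preimage (continuous_toEuclideanLin_pow A m), q, hq, hu.symm⟩
  rintro w ⟨q', hq', hw⟩
  obtain ⟨p, hp, hpw⟩ := (mem_image_pow_iff hT m i _).2 ⟨j, x, hx, q', interior_subset hq', rfl⟩
  rwa [← (hA.bijective_pow m).1 (hpw.trans hw)]

lemma exists_tiles_subset_ball (hcompact : ∀ i, IsCompact (T i)) :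
    ∃ ρ > 0, ∀ i, T i ⊆ Metric.ball 0 ρ := by
  obtain ⟨ρ, hρ, h⟩ := (Bornology.isBounded_iUnion.2 fun i =>
    (hcompact i).isBounded).subset_ball_lt 0 0
  exact ⟨ρ, hρ, fun i => (Set.subset_iUnion T i).trans h⟩

lemma exists_interior_nonempty_of_volume_pos (hA : IsExpanding A)
    (hS : (subdivisionMatrix D).IsPrimitive)
    (hPerron : perronEigenvalue (subdivisionMatrix D) = |A.det|)
    (hcompact : ∀ i, IsCompact (T i)) (hT : SatisfiesMultiTile A D T)
    (hpos : ∃ j, 0 < volume (T j)) : ∃ j, (interior (T j)).Nonempty := by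
  classical
  by_contra! hint
  obtain ⟨ε, hε, hsep⟩ := exists_separation_of_volume_pos hA hS hPerron hcompact hT hpos
  obtain ⟨i, hi⟩ := hpos
  obtain ⟨t, ht⟩ := nonempty_of_measure_ne_zero hi.ne'
  obtain ⟨ρ, hρ, hTρ⟩ := exists_tiles_subset_ball hcompact
  -- A tile meeting the unit ball about `c` has its digit within `1 + ρ` of `c`, so at most `n * N`
  -- tiles do.
  obtain ⟨N, hN⟩ := exists_countIn_ball_le (d := d) hε (1 + ρ)
  obtain ⟨M, hM⟩ := exists_countIn_ball_le (d := d) hε 1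
  obtain ⟨s, hs, hporous⟩ := exists_ball_subset_ball_disjoint_list hcompact hint (n * N) one_pos
  have hfree : ∀ m : ℕ, ∀ c : EuclideanSpace ℝ (Fin d), ∃ c', Metric.ball c' s ⊆ Metric.ball c 1 ∧
      Disjoint (Metric.ball c' s) ((Matrix.toEuclideanLin A ^ m) '' T i) := by
    intro m c
    set F : Finset (Σ j, Fin (digitMultiset A D m j i).toList.length) :=
      Finset.univ.sigma fun j => Finset.univ.filter fun a =>
        (digitMultiset A D m j i).enum a ∈ Metric.ball c (1 + ρ) with hF
    have hcard : F.card ≤ n * N := by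
      rw [hF, Finset.card_sigma]
      refine (Finset.sum_le_card_nsmul _ _ N fun j _ => ?_).trans (by simp)
      rw [← countIn_eq_card_enum]
      exact hN _ (hsep m j i).1 (hsep m j i).2 c
    obtain ⟨c', h1, h2⟩ := hporous
      (F.toList.map fun a : (Σ j, Fin (digitMultiset A D m j i).toList.length) =>
        (a.1, (digitMultiset A D m a.1 i).enum a.2)) (by simpa using hcard) c
    refine ⟨c', h1, Set.disjoint_left.2 fun y hy hyT => ?_⟩
    rw [image_pow_eq_iUnion_tiles hT] at hyT
    obtain ⟨a, ha⟩ := Set.mem_iUnion.1 hyT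
    refine Set.disjoint_left.1 (h2 (a.1, (digitMultiset A D m a.1 i).enum a.2) ?_) hy ha
    refine List.mem_map.2 ⟨a, ?_, rfl⟩
    obtain ⟨q, hq, rfl⟩ := ha
    have hyc := Metric.mem_ball.1 (h1 hy)
    have hq' := mem_ball_zero_iff.1 (hTρ _ hq)
    simp only [hF, Finset.mem_toList, Finset.mem_sigma, Finset.mem_univ, true_and,
      Finset.mem_filter, Metric.mem_ball]
    refine (dist_triangle _ ((digitMultiset A D m a.1 i).enum a.2 + q) _).trans_lt ?_
    rw [dist_self_add_right]
    simp only [vadd_eq_add] at hyc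
    linarith
  obtain ⟨c, hc, K, hK⟩ := exists_const_mul_volume_ball_le hA hS hPerron
  set β := volume (Metric.ball (0 : EuclideanSpace ℝ (Fin d)) s) with hβ
  have hβ0 : β ≠ 0 := (Metric.measure_ball_pos volume _ hs).ne'
  have hδ : 0 < c * β / (M + 1) := ENNReal.div_pos (mul_ne_zero hc hβ0) (by finiteness)
  -- The free balls of radius `s` will lie in `A ^ m (U \ T i)`, too small a set to hold so many of
  -- them.
  obtain ⟨U, hTU, hU, -, hUδ⟩ := (hcompact i).measurableSet.exists_isOpen_sdiff_lt
    ((hcompact i).measure_ne_top (μ := volume)) hδ.ne'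
  obtain ⟨m, hm, hmK⟩ := ((hA.eventually_ball_subset_image_of_isCompact (hcompact i) hU hTU).and
    (Filter.eventually_ge_atTop K)).exists
  have h1 := hK m hmK i i M (fun y => hM _ (hsep m i i).1 (hsep m i i).2 y) t s (U \ T i)
    fun x hx => by
      obtain ⟨p, hp, hpx⟩ := (mem_image_pow_iff hT m i _).2 ⟨i, x, hx, t, ht, rfl⟩
      obtain ⟨c', h1, h2⟩ := hfree m (x + t)
      refine ⟨c', h1, fun y hy => ?_⟩
      obtain ⟨w, hw, rfl⟩ := hm p hp (hpx ▸ h1 hy)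
      exact ⟨w, ⟨hw, fun hwT => Set.disjoint_left.1 h2 hy ⟨w, hwT, rfl⟩⟩, rfl⟩
  have h2 : (M + 1) * volume (U \ T i) < c * β := by
    rw [mul_comm]; exact (ENNReal.lt_div_iff_mul_lt (by simp) (by simp)).1 hUδ
  have h3 : (M : ENNReal) * volume (U \ T i) ≤ (M + 1) * volume (U \ T i) := by gcongr; simp
  exact absurd (h1.trans h3) (not_le.2 h2)

lemma interior_nonempty_of_exists (hA : IsExpanding A)
    (hS : (subdivisionMatrix D).IsPrimitive) (hT : SatisfiesMultiTile A D T)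
    (hint : ∃ j, (interior (T j)).Nonempty) (i : Fin n) : (interior (T i)).Nonempty := by
  obtain ⟨j, q, hq⟩ := hint
  obtain ⟨K, hK⟩ := exists_mem_digitMultiset_of_isPrimitive A hS
  obtain ⟨x, hx⟩ := hK j i
  obtain ⟨u, hu⟩ := (hA.bijective_pow K).2 (x + q)
  exact ⟨u, mem_interior_of_pow_apply_eq hA hT hx hq hu⟩

lemma add_mem_ball_of_mem {ρ : ℝ} (hTρ : ∀ i, T i ⊆ Metric.ball 0 ρ) {j : Fin n}
    {x p q : EuclideanSpace ℝ (Fin d)} (hp : p ∈ T j) (hq : q ∈ T j) :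
    x + q ∈ Metric.ball (x + p) (2 * ρ) := by
  have h1 := mem_ball_zero_iff.1 (hTρ _ hp)
  have h2 := mem_ball_zero_iff.1 (hTρ _ hq)
  rw [Metric.mem_ball, dist_add_left, dist_eq_norm]
  exact (norm_sub_le _ _).trans_lt (by linarith)

/-- For large `m` the tile of `A ^ m (T i)` containing `A ^ m p` pulls back to a set within `ε` of
`p`, and it has interior points. -/
lemma eq_closure_interior (hA : IsExpanding A) (hcompact : ∀ i, IsCompact (T i))
    (hT : SatisfiesMultiTile A D T) (hint : ∀ j, (interior (T j)).Nonempty) (i : Fin n) :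
    T i = closure (interior (T i)) := by
  refine Set.Subset.antisymm (fun p hp => Metric.mem_closure_iff.2 fun ε hε => ?_)
    ((hcompact i).isClosed.closure_interior_subset)
  obtain ⟨ρ, hρ, hTρ⟩ := exists_tiles_subset_ball hcompact
  obtain ⟨m, hm⟩ := (hA.eventually_ball_subset_image hε (2 * ρ)).exists
  obtain ⟨j, x, hx, q, hq, hpx⟩ := (mem_image_pow_iff hT m i _).1 ⟨p, hp, rfl⟩
  obtain ⟨q', hq'⟩ := hint j
  obtain ⟨u, hu, hux⟩ := hm p (hpx ▸ add_mem_ball_of_mem hTρ hq (interior_subset hq'))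
  exact ⟨u, mem_interior_of_pow_apply_eq hA hT hx hq' hux, by rwa [dist_comm]⟩

lemma image_pow_frontier_subset (hA : IsExpanding A) (hcompact : ∀ i, IsCompact (T i))
    (hT : SatisfiesMultiTile A D T) (m : ℕ) (i : Fin n) :
    (Matrix.toEuclideanLin A ^ m) '' frontier (T i) ⊆
      ⋃ a : (Σ j, Fin (digitMultiset A D m j i).toList.length),
        (digitMultiset A D m a.1 i).enum a.2 +ᵥ frontier (T a.1) := by
  rintro _ ⟨p, hp, rfl⟩
  have h1 : (Matrix.toEuclideanLin A ^ m) p ∈ (Matrix.toEuclideanLin A ^ m) '' T i :=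
    ⟨p, (hcompact i).isClosed.frontier_subset hp, rfl⟩
  rw [image_pow_eq_iUnion_tiles hT] at h1
  obtain ⟨a, q, hq, hqp⟩ := Set.mem_iUnion.1 h1
  refine Set.mem_iUnion.2 ⟨a, q, ⟨subset_closure hq, fun hq' => hp.2 ?_⟩, hqp⟩
  exact mem_interior_of_pow_apply_eq hA hT (Multiset.enum_mem _ a.2) hq' hqp.symm

/-- If some frontier had positive volume, the volumes of all frontiers would form a positive
eigenvector, so no tile could be dropped from the covering of `A ^ m (frontier (T i))`. For large
`m` one can be. -/
lemma volume_frontier_eq_zero (hA : IsExpanding A)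
    (hS : (subdivisionMatrix D).IsPrimitive)
    (hPerron : perronEigenvalue (subdivisionMatrix D) = |A.det|)
    (hcompact : ∀ i, IsCompact (T i)) (hT : SatisfiesMultiTile A D T)
    (hint : ∀ j, (interior (T j)).Nonempty) (i : Fin n) : volume (frontier (T i)) = 0 := by
  classical
  by_contra h0
  have hfin : ∀ j, volume (frontier (T j)) ≠ ⊤ := fun j =>
    ne_top_of_le_ne_top (hcompact j).measure_ne_top
      (measure_mono (hcompact j).isClosed.frontier_subset)
  obtain ⟨hpos, heq⟩ := volume_pos_and_pow_mul_volume_eq hA hS hPerron hfin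
    (fun i => image_pow_frontier_subset hA hcompact hT 1 i) ⟨i, pos_iff_ne_zero.2 h0⟩
  obtain ⟨ρ, hρ, hTρ⟩ := exists_tiles_subset_ball hcompact
  obtain ⟨p, hp⟩ := hint i
  obtain ⟨ε, hε, hball⟩ := Metric.isOpen_iff.1 isOpen_interior p hp
  obtain ⟨m, hm⟩ := (hA.eventually_ball_subset_image hε (2 * ρ)).exists
  have h1 : (Matrix.toEuclideanLin A ^ m) p ∈ (Matrix.toEuclideanLin A ^ m) '' T i :=
    ⟨p, interior_subset hp, rfl⟩
  rw [image_pow_eq_iUnion_tiles hT] at h1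
  obtain ⟨b, q, hq, hqp⟩ := Set.mem_iUnion.1 h1
  -- The tile `b` contains `A ^ m p` and has diameter at most `2 * ρ`, so it lies in the image of
  -- the ball about `p` inside `interior (T i)` and misses the image of the frontier.
  have h2 := pow_mul_volume_le_sum (F := Finset.univ.erase b) (i := i) hfin (by
    intro y hy
    obtain ⟨a, ha⟩ := Set.mem_iUnion.1 (image_pow_frontier_subset hA hcompact hT m i hy)
    refine Set.mem_biUnion (x := a) ?_ ha
    simp only [Finset.coe_erase, Finset.coe_univ, Set.mem_sdiff, Set.mem_univ, true_and,
      Set.mem_singleton_iff]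
    rintro rfl
    obtain ⟨w, hw, rfl⟩ := hy
    obtain ⟨q', hq', hqw⟩ := ha
    have hmem : (digitMultiset A D m a.1 i).enum a.2 + q' ∈
        Metric.ball ((Matrix.toEuclideanLin A ^ m) p) (2 * ρ) := by
      rw [← hqp]
      exact add_mem_ball_of_mem hTρ hq ((hcompact _).isClosed.frontier_subset hq')
    obtain ⟨u, hu, huq⟩ := hm p hmem
    rw [← (hA.bijective_pow m).1 (huq.trans hqw)] at hw
    exact hw.2 (hball hu))
  have h3 := Finset.add_sum_erase Finset.univ
    (fun a : (Σ j, Fin (digitMultiset A D m j i).toList.length) =>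
      (volume (frontier (T a.1))).toReal) (Finset.mem_univ b)
  have h4 := ENNReal.toReal_pos (hpos b.1).ne' (hfin b.1)
  have h5 := heq m i
  linarith

end tiles

/-! ### The equivalences -/

theorem mainTheorem4 {d n : ℕ} (A : Matrix (Fin d) (Fin d) ℝ)
    (D : Fin n → Fin n → Finset (EuclideanSpace ℝ (Fin d)))
    (T : Fin n → Set (EuclideanSpace ℝ (Fin d)))
    (hA : IsExpanding A)
    (hS : (subdivisionMatrix D).IsPrimitive)
    (hPerron : perronEigenvalue (subdivisionMatrix D) = |A.det|)
    (hcompact : ∀ i, IsCompact (T i))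
    (hne : ∃ i, (T i).Nonempty)
    (hT : SatisfiesMultiTile A D T) :
    List.TFAE [
      -- (i)
      (∀ (m : ℕ) (j k : Fin n), 1 ≤ m → (digitMultiset A D m j k).Nodup) ∧
        EquiUniformlyDiscrete
          (fun p : Fin n × Fin n × ℕ+ => digitMultiset A D p.2.2 p.1 p.2.1),
      -- (ii)
      ∃ k l : Fin n, (∀ m : ℕ, 1 ≤ m → (digitMultiset A D m k l).Nodup) ∧
        EquiUniformlyDiscrete (fun m : ℕ+ => digitMultiset A D m k l),
      -- (iii)
      WeaklyEquiUniformlyDiscrete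
        (fun p : Fin n × Fin n × ℕ+ => digitMultiset A D p.2.2 p.1 p.2.1),
      -- (iv)
      ∃ k l : Fin n,
        WeaklyEquiUniformlyDiscrete (fun m : ℕ+ => digitMultiset A D m k l),
      -- (v)
      ∃ j, 0 < MeasureTheory.volume (T j),
      -- (vi)
      ∀ j, T j = closure (interior (T j)),
      -- (vii)
      (∀ j, T j = closure (interior (T j))) ∧
        ∀ k, MeasureTheory.volume (frontier (T k)) = 0] ∧
    ((∀ j, T j = closure (interior (T j))) →
      ∀ j, 0 < MeasureTheory.volume (T j)) := by
  have hvi : (∀ j, T j = closure (interior (T j))) → ∀ j, 0 < volume (T j) := by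
    intro h j
    have hj := nonempty_of_isPrimitive hS hne hT j
    rw [h j, closure_nonempty_iff] at hj
    exact (isOpen_interior.measure_pos volume hj).trans_le (measure_mono interior_subset)
  obtain ⟨i0, -⟩ := id hne
  refine ⟨?_, hvi⟩
  tfae_have 1 → 2 := by
    rintro ⟨h1, ε, hε, h2⟩
    exact ⟨i0, i0, fun m hm => h1 m i0 i0 hm, ε, hε, fun m => h2 (i0, i0, m)⟩
  tfae_have 1 → 3 := fun ⟨h1, h2⟩ => h2.weakly fun p => h1 _ _ _ p.2.2.2
  tfae_have 2 → 4 := fun ⟨k, l, h1, h2⟩ => ⟨k, l, h2.weakly fun m => h1 _ m.2⟩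
  tfae_have 3 → 4 := fun ⟨M, h⟩ => ⟨i0, i0, M, fun m => h (i0, i0, m)⟩
  tfae_have 4 → 5 := fun ⟨k, l, h⟩ =>
    ⟨l, volume_pos_of_weaklyEquiUniformlyDiscrete hA hS hPerron hcompact hne hT h⟩
  tfae_have 5 → 1 := by
    intro h
    obtain ⟨ε, hε, hsep⟩ := exists_separation_of_volume_pos hA hS hPerron hcompact hT h
    exact ⟨fun m j k _ => (hsep m j k).1, ε, hε, fun p =>
      ⟨uniformlyDiscrete_of_nodup_of_le_dist (hsep _ _ _).1 hε (hsep _ _ _).2, (hsep _ _ _).2⟩⟩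
  tfae_have 5 → 7 := by
    intro h
    have hint := interior_nonempty_of_exists hA hS hT
      (exists_interior_nonempty_of_volume_pos hA hS hPerron hcompact hT h)
    exact ⟨eq_closure_interior hA hcompact hT hint,
      volume_frontier_eq_zero hA hS hPerron hcompact hT hint⟩
  tfae_have 7 → 6 := And.left
  tfae_have 6 → 5 := fun h => ⟨i0, hvi h i0⟩
  tfae_finish
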